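/- Let $T=([0,1]\times[0,1])\cup([-\tfrac12,\tfrac32]\times[1,\tfrac32])$, let $\phi_1(\mathbf x)=\tfrac12\mathbf x+(1,\tfrac32)$ and $\phi_2(\mathbf x)=\tfrac12\mathbf x+(-\tfrac12,\tfrac32)$, and for $n\ge 0$ let $$\Omega(\mathscr T_n)=\bigcup_{j=0}^{n}\ \bigcup_{i_1,\dots,i_j\in\{1,2\}}\phi_{i_1}\circ\cdots\circ\phi_{i_j}(T)$$ be the $n$-th prefractal $T$-fractal billiard table. Its base is $I=[0,1]\times\{0\}$. The segments removed in the construction of $\Omega(\mathscr T_{n+1})$ from $\Omega(\mathscr T_n)$ are the $2^{n+1}$ segments $\phi_{i_1}\circ\cdots\circ\phi_{i_{n+1}}(I)$ of the boundary of $\Omega(\mathscr T_n)$. Given a point $x\in(0,1)$ and $\theta\in(0,\pi)$, consider in each $\Omega(\mathscr T_n)$ the billiard orbit $(x_n^k,\theta_n^k)_{k\ge 0}$ with $x_n^0=(x,0)$ and $\theta_n^0=\theta$; here $x_n^k$ is the $k$-th collision point with the boundary, $\theta_n^k$ is the direction of motion after that collision, and the orbit stops at a vertex where the reflection is not well defined.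 The first return time $\upsilon_n$ is the least $k\ge1$ with $x_n^k\in I$. The first escape time $\tau_n$ is the least $k\ge 1$ such that $x_n^k$ lies on a segment removed in the construction of $\Omega(\mathscr T_{n+1})$ from $\Omega(\mathscr T_n)$. Either time is $\infty$ if there is no such $k$. If $\tau_n<\infty$, the relative origin $O_n$ of the escape point $x_n^{\tau_n}$ is the left endpoint of the removed segment containing it if the ball moves to the right just before reaching $x_n^{\tau_n}$, and the right endpoint if it moves to the left. For $y\in(0,1)$ that is not a dyadic rational, let $(y)_k=2^{-k}\lfloor 2^k y\rfloor$ be the number given by the first $k$ binary digits of $y$. Let $p\ge1$ be an odd integer and let $x\in(0,1)$ be such that $x\ne m2^{-l}$ for all positive integers $m,l$. Let $\theta\in(0,\pi)$ with $\tan\theta=\frac1p$ or $\tan\theta=-\frac1p$. Then for every $n\ge0$ the first escape time $\tau_n$ is finite and $\tau_n<\upsilon_n$. Moreover, for every $n\ge 0$, $$|x_n^{\tau_n}-O_n|=x-(x)_{n+1}\quad\text{if }\tan\theta=\tfrac1p,\qquad |x_n^{\tau_n}-O_n|=(1-x)-(1-x)_{n+1}\quad\text{if }\tan\theta=-\tfrac1p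 .$$ -/

import Mathlib

open Set

/-- The Euclidean plane. -/
abbrev Plane : Type := EuclideanSpace ℝ (Fin 2)

/-! ### Polygonal billiards -/

/-- A direction `v` points into the table `Ω` at the point `P`. -/
def InwardAt (Ω : Set Plane) (P v : Plane) : Prop :=
  ∃ ε : ℝ, 0 < ε ∧ ∀ s ∈ Ioo (0 : ℝ) ε, P + s • v ∈ interior Ω

/-- The group generated by the linear reflections in the boundary edges of the table `Ω` that
contain `P`: one reflection if `P` is not a vertex, two if it is a vertex. -/
noncomputable def edgeGroup (Ω : Set Plane) (P : Plane) : Subgroup (Plane ≃ₗᵢ[ℝ] Plane) :=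
  Subgroup.closure
    {ρ | ∃ Q : Plane, Q ≠ P ∧ segment ℝ P Q ⊆ frontier Ω ∧ ρ = (ℝ ∙ (Q - P)).reflection}

/-- The graph of the billiard map `f` of the table `Ω`, on pairs (basepoint, inward direction).
From `a.1` the ball moves in the direction `a.2` through the interior of the table up to the first
boundary point `b.1`. The new direction `b.2` is `ρ a.2`, where `ρ` is the only element of the
group generated by the reflections in the edges through `b.1` such that `ρ a.2` points inward.
If there is no such element, or more than one, as at a vertex where the interior angle exceeds
`π`, then the motion stops. -/
def BilliardStep (Ω : Set Plane) (a b : Plane × Plane) : Prop :=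
  (∃ t : ℝ, 0 < t ∧ b.1 = a.1 + t • a.2 ∧ (∀ s ∈ Ioo (0 : ℝ) t, a.1 + s • a.2 ∈ interior Ω)) ∧
  b.1 ∈ frontier Ω ∧
  ∃ ρ ∈ edgeGroup Ω b.1, b.2 = ρ a.2 ∧ InwardAt Ω b.1 (ρ a.2) ∧
    ∀ ρ' ∈ edgeGroup Ω b.1, InwardAt Ω b.1 (ρ' a.2) → ρ' = ρ

/-- The billiard map is single-valued. -/
theorem BilliardStep.unique {Ω : Set Plane} {a b c : Plane × Plane}
    (hb : BilliardStep Ω a b) (hc : BilliardStep Ω a c) : b = c := by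
  obtain ⟨⟨t, ht, hbt, hti⟩, hbf, ρ, hρ, hbρ, hρi, hρu⟩ := hb
  obtain ⟨⟨u, hu, hcu, hui⟩, hcf, σ, hσ, hcσ, hσi, hσu⟩ := hc
  have htu : t = u := by
    rcases lt_trichotomy t u with h | h | h
    · exact absurd (hbt ▸ hui t ⟨ht, h⟩) hbf.2
    · exact h
    · exact absurd (hcu ▸ hti u ⟨hu, h⟩) hcf.2
  subst htu
  have h1 : b.1 = c.1 := hbt.trans hcu.symm
  have h2 : ρ = σ := hσu ρ (h1 ▸ hρ) (h1 ▸ hρi)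
  exact Prod.ext h1 (by rw [hbρ, hcσ, h2])

/-- `OrbitAt Ω a k b`: the `k`-th iterate of the billiard map of `Ω` is defined at `a` and is
`b`, that is, `b` is the pair `(x^k, θ^k)` of the orbit with initial condition `a`. -/
inductive OrbitAt (Ω : Set Plane) (a : Plane × Plane) : ℕ → Plane × Plane → Prop
  | zero : OrbitAt Ω a 0 a
  | succ {k : ℕ} {b c : Plane × Plane} :
      OrbitAt Ω a k b → BilliardStep Ω b c → OrbitAt Ω a (k + 1) c

/-- The least positive integer `k` such that the `k`-th basepoint of the orbit of `a` lies in
`S`; it is `⊤` (infinity) if there is none. -/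
noncomputable def firstHit (Ω : Set Plane) (a : Plane × Plane) (S : Set Plane) : ℕ∞ :=
  sInf {κ : ℕ∞ | ∃ k : ℕ, κ = k ∧ 0 < k ∧ ∃ b, OrbitAt Ω a k b ∧ b.1 ∈ S}

/-! ### The prefractal tables -/

/-- The two similarities that generate the fractal: `phi 0` leads to the right copy, `phi 1` to
the left copy. -/
noncomputable def phi (i : Fin 2) (P : Plane) : Plane :=
  (1 / 2 : ℝ) • P + ![!₂[1, 3 / 2], !₂[-1 / 2, 3 / 2]] i

/-- The composition `phi i₁ ∘ ⋯ ∘ phi iⱼ` given by a word `[i₁, …, iⱼ]`. -/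
noncomputable def phiWord : List (Fin 2) → Plane → Plane
  | [] => id
  | i :: w => phi i ∘ phiWord w

/-- The `T`-shaped table: a `1 × 1` square, and a `2 × 1/2` rectangle centred on top of it. -/
def tableZero : Set Plane :=
  {P | P 0 ∈ Icc (0 : ℝ) 1 ∧ P 1 ∈ Icc (0 : ℝ) 1} ∪
    {P | P 0 ∈ Icc (-1 / 2 : ℝ) (3 / 2) ∧ P 1 ∈ Icc (1 : ℝ) (3 / 2)}

/-- The `n`-th prefractal table, the union of the images of `tableZero` under the compositions of
at most `n` of the maps `phi i`. -/
def table (n : ℕ) : Set Plane :=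
  ⋃ w ∈ {w : List (Fin 2) | w.length ≤ n}, phiWord w '' tableZero

/-- The base of the tables: the unit interval on the horizontal axis. -/
def base : Set Plane := segment ℝ (!₂[0, 0] : Plane) !₂[1, 0]

/-- The segment along which the copy `phiWord w '' tableZero` is attached. With `w` of length
`n + 1`, these are the segments of the boundary of `table n` that are removed in the construction
of `table (n + 1)`. -/
def removedSegment (w : List (Fin 2)) : Set Plane := phiWord w '' base

/-- The points of the boundary of `table n` on the segments to be removed in the construction of
`table (n + 1)`. -/
def removed (n : ℕ) : Set Plane :=
  ⋃ w ∈ {w : List (Fin 2) | w.length = n + 1}, removedSegment w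

/-- The first return time of an orbit of `table n` that starts on the base. -/
noncomputable def firstReturnTime (n : ℕ) (a : Plane × Plane) : ℕ∞ :=
  firstHit (table n) a base

/-- The first escape time of an orbit of `table n`. -/
noncomputable def firstEscapeTime (n : ℕ) (a : Plane × Plane) : ℕ∞ :=
  firstHit (table n) a (removed n)

/-- The relative origin of a point of `removedSegment w` that is reached in the upward,
non-vertical direction `v`: the left endpoint of the segment if `v` points to the right, and the
right endpoint if `v` points to the left. -/
noncomputable def relativeOrigin (w : List (Fin 2)) (v : Plane) : Plane :=
  if 0 < v 0 then phiWord w !₂[0, 0] else phiWord w !₂[1, 0]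

/-- The number given by the first `k` digits of the infinite binary expansion of a non-dyadic
`x ∈ (0, 1)`. -/
noncomputable def binaryTrunc (k : ℕ) (x : ℝ) : ℝ := (⌊(2 : ℝ) ^ k * x⌋ : ℝ) / 2 ^ k

/-- The initial condition with basepoint `x` on the base and direction `θ`. -/
noncomputable def initialCondition (x θ : ℝ) : Plane × Plane :=
  (!₂[x, 0], !₂[Real.cos θ, Real.sin θ])

/-- In `table n`, the orbit of `a` has a finite first escape time, which is less than its first
return time, and its escape point lies at distance `d` from its relative origin, this being taken
with respect to the direction of motion prior to the collision. -/
def EscapesAtDistance (n : ℕ) (a : Plane × Plane) (d : ℝ) : Prop :=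
  ∃ k : ℕ, firstEscapeTime n a = ((k + 1 : ℕ) : ℕ∞) ∧
    firstEscapeTime n a < firstReturnTime n a ∧
    ∃ b c : Plane × Plane, OrbitAt (table n) a k b ∧ BilliardStep (table n) b c ∧
      ∃ w : List (Fin 2), w.length = n + 1 ∧ c.1 ∈ removedSegment w ∧
        dist c.1 (relativeOrigin w b.2) = d

/-! Follow the ball through one copy of the `T`, rescaled to unit base, and record the distance `u`
from the base endpoint behind it. Rising through the stem it moves `p` units sideways in a strip of
width 1; as `p` is odd, it bounces `p` times and enters the bar reversed, again at distance `u` from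
the stem wall behind it, hence at `u + 1/2` from the bar wall behind it. Each crossing of the bar,
up or down, adds `p/2` to this distance modulo the bar width 2, the wall behind being switched at
each bounce. Hence the first arrival on top is at `u + 1` if `p ≡ 1 (mod 4)` and at `u` if `p ≡ 3
(mod 4)`. Either this lies on a removed segment, or the ball bounces off the middle of the ceiling,
then off the floor of the bar, and the next arrival does. In all cases the exit is at `u` for `u <
1/2` and at `u + 1` for `u > 1/2`. On the base of the smaller copy, rescaled by 2, the new distance
is the fractional part of `2u` (`traverse_copy`).

Thus `n + 1` copies iterate the doubling map `n + 1` times, and scaling back gives `2^(-(n+1)) *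
fract (2^(n+1) * u) = u - (u)_{n+1}`. A non-dyadic `u` keeps the ball away from all vertices. No
earlier collision is on the base or on a removed segment, which gives the escape time and its
comparison with the return time. Slope `-1/p` is the same motion with `u = 1 - x`.

Two devices carry this: `IsWall`, a local description of the table that determines the billiard step
and is transported to smaller copies by `phiWord`; and `Passes`/`Arrives`, which forget the number
of collisions so that flights can be concatenated. -/

open Filter Topology

/-! ### Straight walls and the reflection law -/

/-- Near `P`, the set `Ω` is the half-plane with outward normal `σ` times the `i`-th unit vector
whose boundary line contains `P`. -/
def IsWall (Ω : Set Plane) (P : Plane) (i : Fin 2) (σ : ℝ) : Prop :=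
  ∀ᶠ Q in 𝓝 P, (Q ∈ Ω ↔ σ * Q i ≤ σ * P i)

/-- The reflection of the plane that changes the sign of the `i`-th coordinate. -/
noncomputable def axisReflection (i : Fin 2) : Plane ≃ₗᵢ[ℝ] Plane :=
  (ℝ ∙ (EuclideanSpace.single i.rev (1 : ℝ) : Plane)).reflection

theorem axisReflection_apply (i : Fin 2) (v : Plane) :
    axisReflection i v = (2 * v i.rev) • (EuclideanSpace.single i.rev (1 : ℝ) : Plane) - v := by
  rw [axisReflection, Submodule.reflection_singleton_apply]
  simp [EuclideanSpace.inner_single_left]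
  module

theorem axisReflection_zero (a b : ℝ) : axisReflection 0 !₂[a, b] = !₂[-a, b] := by
  rw [axisReflection_apply]
  ext j
  fin_cases j <;> (simp [Fin.rev]; try ring)

theorem axisReflection_one (a b : ℝ) : axisReflection 1 !₂[a, b] = !₂[a, -b] := by
  rw [axisReflection_apply]
  ext j
  fin_cases j <;> (simp [Fin.rev]; try ring)

theorem axisReflection_apply_self (i : Fin 2) (v : Plane) : axisReflection i v i = -v i := by
  rw [axisReflection_apply]
  fin_cases i <;> simp [Fin.rev]

theorem axisReflection_mul_self (i : Fin 2) : axisReflection i * axisReflection i = 1 :=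
  Submodule.reflection_mul_reflection _

theorem axisReflection_eq {i : Fin 2} {P Q : Plane} (hne : Q ≠ P) (h : Q i = P i) :
    (ℝ ∙ (Q - P)).reflection = axisReflection i := by
  have hQ : Q - P = (Q i.rev - P i.rev) • (EuclideanSpace.single i.rev (1 : ℝ) : Plane) := by
    ext j
    fin_cases i <;> fin_cases j <;> simp_all [Fin.rev]
  have hc : Q i.rev - P i.rev ≠ 0 := by
    intro h0
    rw [h0, zero_smul, sub_eq_zero] at hQ
    exact hne hQ
  have hs : (ℝ ∙ (Q - P)) = ℝ ∙ (EuclideanSpace.single i.rev (1 : ℝ) : Plane) := by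
    rw [hQ, Submodule.span_singleton_smul_eq hc.isUnit]
  rw [axisReflection]
  congr 1

theorem continuous_coord (i : Fin 2) : Continuous fun P : Plane => P i := by fun_prop

theorem tendsto_add_smul (P v : Plane) : Tendsto (fun s : ℝ => P + s • v) (𝓝 0) (𝓝 P) := by
  have h : Continuous fun s : ℝ => P + s • v := by fun_prop
  simpa using h.tendsto 0

namespace IsWall

variable {Ω : Set Plane} {P : Plane} {i : Fin 2} {σ : ℝ}

theorem eventually_interior (h : IsWall Ω P i σ) :
    ∀ᶠ Q in 𝓝 P, σ * Q i < σ * P i → Q ∈ interior Ω := by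
  filter_upwards [eventually_eventually_nhds.2 h] with Q hQ hlt
  have h1 : ∀ᶠ R in 𝓝 Q, σ * R i < σ * P i :=
    ((continuous_coord i).const_mul σ).continuousAt.eventually_lt_const hlt
  rw [mem_interior_iff_mem_nhds]
  filter_upwards [hQ, h1] with R hR hRl using hR.2 hRl.le

theorem not_mem_interior_of_eq (h : IsWall Ω P i σ) (hσ : σ ≠ 0) :
    ∀ᶠ Q in 𝓝 P, Q i = P i → Q ∉ interior Ω := by
  filter_upwards [eventually_eventually_nhds.2 h] with Q hQ hlt hint
  have h1 := hQ.and (mem_interior_iff_mem_nhds.1 hint)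
  -- A short step from `Q` along the outward normal leaves `Ω`; the factor `σ` in the vector makes
  -- `σ` times the coordinate grow by `s * σ²`.
  have h2 := (tendsto_add_smul Q (EuclideanSpace.single i σ)).eventually h1
  obtain ⟨s, hs, hs0⟩ := ((h2.filter_mono nhdsWithin_le_nhds).and
    (self_mem_nhdsWithin : Ioi (0 : ℝ) ∈ 𝓝[>] 0)).exists
  have h3 := hs.1.1 hs.2
  have hs1 : 0 < s := hs0
  simp only [PiLp.add_apply, PiLp.smul_apply, PiLp.single_apply, if_true, smul_eq_mul,
    hlt] at h3
  have : 0 < s * (σ * σ) := mul_pos hs1 (mul_self_pos.2 hσ)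
  linarith

theorem eventually_frontier (h : IsWall Ω P i σ) (hσ : σ ≠ 0) :
    ∀ᶠ Q in 𝓝 P, (Q ∈ frontier Ω ↔ Q i = P i) := by
  filter_upwards [h.eventually_interior, h.not_mem_interior_of_eq hσ,
    eventually_eventually_nhds.2 h] with Q h1 h2 h3
  constructor
  · intro hQ
    rcases lt_trichotomy (σ * Q i) (σ * P i) with hl | he | hg
    · exact absurd (h1 hl) hQ.2
    · exact mul_left_cancel₀ hσ he
    · exfalso
      have h4 : ∀ᶠ R in 𝓝 Q, σ * P i < σ * R i :=
        ((continuous_coord i).const_mul σ).continuousAt.eventually_const_lt hg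
      have h5 : ∃ᶠ R in 𝓝 Q, R ∈ Ω := mem_closure_iff_frequently.1 hQ.1
      obtain ⟨R, hR, hR1, hR2⟩ := (h5.and_eventually (h3.and h4)).exists
      exact absurd (hR1.1 hR) (not_le.2 hR2)
  · intro hQ
    refine ⟨subset_closure (h3.self_of_nhds.2 (by rw [hQ])), h2 hQ⟩

theorem mem_frontier (h : IsWall Ω P i σ) (hσ : σ ≠ 0) : P ∈ frontier Ω :=
  (h.eventually_frontier hσ).self_of_nhds.2 rfl

theorem axisReflection_mem (h : IsWall Ω P i σ) (hσ : σ ≠ 0) :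
    axisReflection i ∈ edgeGroup Ω P := by
  set e : Plane := EuclideanSpace.single i.rev (1 : ℝ) with he
  have hei : e i = 0 := by
    fin_cases i <;> simp [he, Fin.rev]
  have h1 := (tendsto_add_smul P e).eventually (h.eventually_frontier hσ)
  obtain ⟨ε, hε, hball⟩ := Metric.eventually_nhds_iff.1 h1
  have hQ : P + (ε / 2) • e ≠ P := by
    simp [he, hε.ne']
  refine Subgroup.subset_closure ⟨P + (ε / 2) • e, hQ, ?_, ?_⟩
  · rw [segment_eq_image']
    rintro _ ⟨t, ⟨ht0, ht1⟩, rfl⟩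
    have hd : dist (t * (ε / 2)) 0 < ε := by
      rw [Real.dist_eq, sub_zero, abs_of_nonneg (by positivity)]
      nlinarith
    have h2 := (hball hd).2 (by simp [hei])
    simpa [smul_smul] using h2
  · exact (axisReflection_eq hQ (by simp [hei])).symm

/-- The initial part of any boundary segment from `P` lies in the wall line, which fixes its
direction. So there is a single generator, and it is an involution. -/
theorem eq_of_mem_edgeGroup (h : IsWall Ω P i σ) (hσ : σ ≠ 0) {ρ : Plane ≃ₗᵢ[ℝ] Plane}
    (hρ : ρ ∈ edgeGroup Ω P) : ρ = 1 ∨ ρ = axisReflection i := by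
  induction hρ using Subgroup.closure_induction with
  | mem ρ hρ =>
    obtain ⟨Q, hQ, hseg, rfl⟩ := hρ
    refine Or.inr (axisReflection_eq hQ ?_)
    have h1 := (tendsto_add_smul P (Q - P)).eventually (h.eventually_frontier hσ)
    obtain ⟨s, hs, hs0, hs1⟩ := ((h1.filter_mono nhdsWithin_le_nhds).and
      (Ioo_mem_nhdsGT (zero_lt_one' ℝ))).exists
    have h2 := hs.1 (hseg (by
      rw [segment_eq_image']
      exact ⟨s, ⟨hs0.le, hs1.le⟩, rfl⟩))
    have h3 : s * (Q i - P i) = 0 := by simpa using h2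
    rcases mul_eq_zero.1 h3 with h4 | h4
    · exact absurd h4 hs0.ne'
    · exact sub_eq_zero.1 h4
  | one => exact Or.inl rfl
  | mul a b _ _ ha hb =>
    rcases ha with rfl | rfl <;> rcases hb with rfl | rfl <;> simp [axisReflection_mul_self]
  | inv a _ ha =>
    rcases ha with rfl | rfl
    · simp
    · exact Or.inr (inv_eq_of_mul_eq_one_left (axisReflection_mul_self i))

/-- A ball that reaches a wall is reflected in it. -/
theorem billiardStep (h : IsWall Ω P i σ) {a : Plane × Plane} {t : ℝ} (ht : 0 < t)
    (hP : P = a.1 + t • a.2) (hint : ∀ s ∈ Ioo (0 : ℝ) t, a.1 + s • a.2 ∈ interior Ω)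
    (hv : 0 < σ * a.2 i) : BilliardStep Ω a (P, axisReflection i a.2) := by
  have hσ : σ ≠ 0 := by
    rintro rfl
    simp at hv
  refine ⟨⟨t, ht, hP, hint⟩, h.mem_frontier hσ, axisReflection i, h.axisReflection_mem hσ, rfl,
    ?_, ?_⟩
  · have h1 := (tendsto_add_smul P (axisReflection i a.2)).eventually h.eventually_interior
    obtain ⟨ε, hε, hball⟩ := Metric.eventually_nhds_iff.1 h1
    refine ⟨ε, hε, fun s hs => hball ?_ ?_⟩
    · rw [Real.dist_eq, sub_zero, abs_of_pos hs.1]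
      exact hs.2
    · simp only [PiLp.add_apply, PiLp.smul_apply, axisReflection_apply_self, smul_eq_mul]
      nlinarith [mul_pos hs.1 hv]
  · intro ρ hρ hin
    rcases h.eq_of_mem_edgeGroup hσ hρ with rfl | rfl
    -- The identity would keep the outward direction of arrival.
    · exfalso
      obtain ⟨ε, hε, hin⟩ := hin
      have h1 := (tendsto_add_smul P a.2).eventually h
      obtain ⟨s, hs, hs0⟩ := ((h1.filter_mono nhdsWithin_le_nhds).and
        (Ioo_mem_nhdsGT hε)).exists
      have h2 := hs.1 (interior_subset (hin s hs0))
      simp only [PiLp.add_apply, PiLp.smul_apply, smul_eq_mul] at h2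
      nlinarith [mul_pos hs0.1 hv]
    · rfl

end IsWall

/-! ### Orbits in flight -/

theorem OrbitAt.unique {Ω : Set Plane} {a : Plane × Plane} {k : ℕ} {b c : Plane × Plane}
    (hb : OrbitAt Ω a k b) (hc : OrbitAt Ω a k c) : b = c := by
  induction k generalizing b c with
  | zero =>
    cases hb
    cases hc
    rfl
  | succ k ih =>
    cases hb with
    | succ hb hb' =>
      cases hc with
      | succ hc hc' =>
        rw [ih hb hc] at hb'
        exact hb'.unique hc'

/-- The first `k` collisions of the orbit of `a` avoid the set `S`. -/
def Avoids (Ω S : Set Plane) (a : Plane × Plane) (k : ℕ) : Prop :=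
  ∀ j, 0 < j → j ≤ k → ∀ b, OrbitAt Ω a j b → b.1 ∉ S

theorem Avoids.succ {Ω S : Set Plane} {a c : Plane × Plane} {k : ℕ} (h : Avoids Ω S a k)
    (hc : OrbitAt Ω a (k + 1) c) (hcS : c.1 ∉ S) : Avoids Ω S a (k + 1) := by
  intro j hj hjk b hb
  rcases Nat.le_succ_iff.1 hjk with h1 | rfl
  · exact h j hj h1 b hb
  · rwa [hb.unique hc]

theorem Avoids.mono {Ω S S' : Set Plane} {a : Plane × Plane} {k : ℕ} (h : Avoids Ω S a k)
    (hS : S' ⊆ S) : Avoids Ω S' a k :=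
  fun j hj hjk b hb hbS => h j hj hjk b hb (hS hbS)

theorem Avoids.lt_firstHit {Ω S : Set Plane} {a : Plane × Plane} {k : ℕ}
    (h : Avoids Ω S a k) : (k : ℕ∞) < firstHit Ω a S := by
  refine lt_of_lt_of_le (b := ((k + 1 : ℕ) : ℕ∞)) (by exact_mod_cast k.lt_succ_self) ?_
  refine le_sInf ?_
  rintro _ ⟨j, rfl, hj, b, hb, hbS⟩
  rw [Nat.cast_le]
  by_contra! hlt
  exact h j hj (Nat.lt_succ_iff.1 hlt) b hb hbS

theorem Avoids.firstHit_eq {Ω S : Set Plane} {a c : Plane × Plane} {k : ℕ}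
    (h : Avoids Ω S a k) (hc : OrbitAt Ω a (k + 1) c) (hcS : c.1 ∈ S) :
    firstHit Ω a S = ((k + 1 : ℕ) : ℕ∞) := by
  refine le_antisymm (sInf_le ⟨k + 1, rfl, k.succ_pos, c, hc, hcS⟩) ?_
  rw [Nat.cast_succ]
  exact Order.add_one_le_of_lt h.lt_firstHit

/-- The orbit of `a` passes `q` with direction `v`, and none of its collisions up to then is
in `S`. Here `q` is interior, or it is the last collision point and `v` is the new direction. -/
def Passes (Ω S : Set Plane) (a : Plane × Plane) (q v : Plane) : Prop :=
  ∃ k b, OrbitAt Ω a k (b, v) ∧ Avoids Ω S a k ∧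
    ∃ t : ℝ, 0 ≤ t ∧ q = b + t • v ∧ ∀ s ∈ Ioc (0 : ℝ) t, b + s • v ∈ interior Ω

/-- The orbit of `a` arrives at `q` with direction `v`, and none of its collisions before that
is in `S`. -/
def Arrives (Ω S : Set Plane) (a : Plane × Plane) (q v : Plane) : Prop :=
  ∃ k b, OrbitAt Ω a k (b, v) ∧ Avoids Ω S a k ∧
    ∃ t : ℝ, 0 < t ∧ q = b + t • v ∧ ∀ s ∈ Ioo (0 : ℝ) t, b + s • v ∈ interior Ω

section Flight

variable {Ω S : Set Plane} {a : Plane × Plane} {q v : Plane}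

theorem Passes.refl (Ω S : Set Plane) (a : Plane × Plane) : Passes Ω S a a.1 a.2 :=
  ⟨0, a.1, OrbitAt.zero, fun _ hj hj' => absurd hj' (not_le.2 hj), 0, le_rfl, by simp,
    fun s hs => absurd hs.1 (not_lt.2 hs.2)⟩

theorem Passes.arrives (h : Passes Ω S a q v) {t : ℝ} (ht : 0 < t)
    (hint : ∀ s ∈ Ioo (0 : ℝ) t, q + s • v ∈ interior Ω) : Arrives Ω S a (q + t • v) v := by
  obtain ⟨k, b, hk, hS, u, hu, rfl, hint'⟩ := h
  refine ⟨k, b, hk, hS, u + t, by linarith, by module, fun s hs => ?_⟩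
  rcases le_or_gt s u with h1 | h1
  · exact hint' s ⟨hs.1, h1⟩
  · have h2 := hint (s - u) ⟨by linarith, by linarith [hs.2]⟩
    rwa [show b + u • v + (s - u) • v = b + s • v by module] at h2

/-- Used where the ball crosses an opening, from stem to bar or from one copy into the next: no
collision is counted there. -/
theorem Arrives.passes (h : Arrives Ω S a q v) (hq : q ∈ interior Ω) : Passes Ω S a q v := by
  obtain ⟨k, b, hk, hS, u, hu, rfl, hint⟩ := h
  refine ⟨k, b, hk, hS, u, hu.le, rfl, fun s hs => ?_⟩
  rcases hs.2.lt_or_eq with h1 | rfl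
  · exact hint s ⟨hs.1, h1⟩
  · exact hq

theorem Arrives.reflect {i : Fin 2} {σ : ℝ} (h : Arrives Ω S a q v) (hw : IsWall Ω q i σ)
    (hv : 0 < σ * v i) (hq : q ∉ S) : Passes Ω S a q (axisReflection i v) := by
  obtain ⟨k, b, hk, hS, u, hu, hqu, hint⟩ := h
  have h1 := OrbitAt.succ hk (hw.billiardStep (a := (b, v)) hu hqu hint hv)
  exact ⟨k + 1, q, h1, hS.succ h1 hq, 0, le_rfl, by simp, fun s hs => absurd hs.1 (not_lt.2 hs.2)⟩

end Flight

/-! ### Self-similarity of the tables -/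

theorem phi_zero_x (P : Plane) : phi 0 P 0 = P 0 / 2 + 1 := by
  simp [phi]; ring

theorem phi_one_x (P : Plane) : phi 1 P 0 = P 0 / 2 - 1 / 2 := by
  simp [phi]; ring

theorem phi_y (i : Fin 2) (P : Plane) : phi i P 1 = P 1 / 2 + 3 / 2 := by
  fin_cases i <;> (simp [phi]; ring)

/-- The inverse of `phi i`. -/
noncomputable def phiInv (i : Fin 2) (P : Plane) : Plane :=
  (2 : ℝ) • (P - ![!₂[1, 3 / 2], !₂[-1 / 2, 3 / 2]] i)

theorem phi_phiInv (i : Fin 2) (P : Plane) : phi i (phiInv i P) = P := by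
  rw [phi, phiInv]
  module

theorem phiInv_phi (i : Fin 2) (P : Plane) : phiInv i (phi i P) = P := by
  rw [phi, phiInv]
  module

theorem phi_injective (i : Fin 2) : Function.Injective (phi i) :=
  Function.LeftInverse.injective (phiInv_phi i)

theorem tendsto_phiInv (i : Fin 2) (P : Plane) :
    Tendsto (phiInv i) (𝓝 (phi i P)) (𝓝 P) := by
  have h : Continuous (phiInv i) := by
    unfold phiInv
    fun_prop
  simpa only [phiInv_phi] using h.tendsto (phi i P)

theorem mem_table_succ {n : ℕ} {P : Plane} :
    P ∈ table (n + 1) ↔ P ∈ tableZero ∨ ∃ i, ∃ Q ∈ table n, phi i Q = P := by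
  simp only [table, mem_iUnion, mem_ofPred_eq, exists_prop]
  constructor
  · rintro ⟨_ | ⟨i, w⟩, hw, Q, hQ, rfl⟩
    · exact Or.inl hQ
    · exact Or.inr ⟨i, phiWord w Q, ⟨w, by simpa using hw, Q, hQ, rfl⟩, rfl⟩
  · rintro (h | ⟨i, _, ⟨w, hw, Q, hQ, rfl⟩, rfl⟩)
    · exact ⟨[], by simp, P, h, rfl⟩
    · exact ⟨i :: w, by simpa using hw, Q, hQ, rfl⟩

theorem table_zero : table 0 = tableZero := by
  ext P
  simp only [table, mem_iUnion, mem_ofPred_eq, exists_prop]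
  constructor
  · rintro ⟨w, hw, Q, hQ, rfl⟩
    obtain rfl : w = [] := by simpa using hw
    exact hQ
  · exact fun h => ⟨[], by simp, P, h, rfl⟩

theorem tableZero_subset (n : ℕ) : tableZero ⊆ table n := by
  cases n with
  | zero => rw [table_zero]
  | succ n => exact fun P h => mem_table_succ.2 (Or.inl h)

theorem tableZero_bounds {P : Plane} (h : P ∈ tableZero) :
    0 ≤ P 1 ∧ P 1 ≤ 3 / 2 ∧ -1 < P 0 ∧ P 0 < 2 ∧ (P 1 < 1 → 0 ≤ P 0 ∧ P 0 ≤ 1) := by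
  rcases h with ⟨⟨h1, h2⟩, h3, h4⟩ | ⟨⟨h1, h2⟩, h3, h4⟩
  · exact ⟨h3, by linarith, by linarith, by linarith, fun _ => ⟨h1, h2⟩⟩
  · exact ⟨by linarith, h4, by linarith, by linarith, fun h => absurd h (not_lt.2 h3)⟩

theorem phi_x_bounds (i : Fin 2) {P : Plane} (h1 : -1 < P 0) (h2 : P 0 < 2) :
    -1 < phi i P 0 ∧ phi i P 0 < 2 := by
  fin_cases i
  · simp only [Fin.zero_eta, phi_zero_x]
    constructor <;> linarith
  · simp only [Fin.mk_one, phi_one_x]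
    constructor <;> linarith

theorem table_bounds {n : ℕ} {P : Plane} (h : P ∈ table n) :
    0 ≤ P 1 ∧ -1 < P 0 ∧ P 0 < 2 ∧ (P 1 < 1 → 0 ≤ P 0 ∧ P 0 ≤ 1) := by
  induction n generalizing P with
  | zero =>
    rw [table_zero] at h
    obtain ⟨h1, -, h2⟩ := tableZero_bounds h
    exact ⟨h1, h2⟩
  | succ n ih =>
    rcases mem_table_succ.1 h with h | ⟨i, Q, hQ, rfl⟩
    · obtain ⟨h1, -, h2⟩ := tableZero_bounds h
      exact ⟨h1, h2⟩
    · obtain ⟨h1, h2, h3, -⟩ := ih hQ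
      rw [phi_y]
      exact ⟨by linarith, (phi_x_bounds i h2 h3).1, (phi_x_bounds i h2 h3).2,
        fun h => by linarith⟩

/-- Below the second generation, only the first copy of `tableZero` matters. -/
theorem mem_table_iff {n : ℕ} {P : Plane} (hP : P 1 < 2)
    (h : P 1 ≤ 3 / 2 ∨ 0 < P 0 ∧ P 0 < 1) : P ∈ table n ↔ P ∈ tableZero := by
  refine ⟨fun hn => ?_, fun hP => tableZero_subset n hP⟩
  cases n with
  | zero => rwa [table_zero] at hn
  | succ n =>
    rcases mem_table_succ.1 hn with hn | ⟨i, Q, hQ, rfl⟩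
    · exact hn
    -- Height below 2 puts `Q` below height 1, hence in a stem, so `phi i Q` lies above one end of
    -- the bar and not above its middle.
    · obtain ⟨h1, -, -, h2⟩ := table_bounds hQ
      rw [phi_y] at hP h
      obtain ⟨h3, h4⟩ := h2 (by linarith)
      rcases h with h | h
      · refine Or.inr ⟨?_, by rw [phi_y]; constructor <;> linarith⟩
        fin_cases i
        · simp only [Fin.zero_eta, phi_zero_x]
          constructor <;> linarith
        · simp only [Fin.mk_one, phi_one_x]
          constructor <;> linarith
      · exfalso
        fin_cases i
        · simp only [Fin.zero_eta, phi_zero_x] at h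
          linarith
        · simp only [Fin.mk_one, phi_one_x] at h
          linarith

/-- The right and the left copies of a table lie on different sides of the axis of symmetry. -/
theorem eq_of_phi_eq {i j : Fin 2} {P Q : Plane} (hP : -1 < P 0 ∧ P 0 < 2)
    (hQ : -1 < Q 0 ∧ Q 0 < 2) (h : phi i P = phi j Q) : i = j ∧ P = Q := by
  have h0 : phi i P 0 = phi j Q 0 := by rw [h]
  have hij : i = j := by
    fin_cases i <;> fin_cases j
    · rfl
    · simp only [Fin.zero_eta, Fin.mk_one, phi_zero_x, phi_one_x] at h0
      linarith
    · simp only [Fin.zero_eta, Fin.mk_one, phi_zero_x, phi_one_x] at h0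
      linarith
    · rfl
  subst hij
  exact ⟨rfl, phi_injective i h⟩

theorem mem_table_succ_iff_phiInv {n : ℕ} {i : Fin 2} {P : Plane} (hy : 3 / 2 < P 1)
    (hx : -1 < phiInv i P 0 ∧ phiInv i P 0 < 2) : P ∈ table (n + 1) ↔ phiInv i P ∈ table n := by
  rw [mem_table_succ]
  constructor
  · rintro (h | ⟨j, Q, hQ, rfl⟩)
    · exact absurd (tableZero_bounds h).2.1 (not_le.2 hy)
    · obtain ⟨-, h1, h2, -⟩ := table_bounds hQ
      obtain ⟨-, h3⟩ := eq_of_phi_eq hx ⟨h1, h2⟩ (phi_phiInv i _)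
      rwa [h3]
  · exact fun h => Or.inr ⟨i, _, h, phi_phiInv i P⟩

/-- Just above height 3/2 the larger table is locally the copy alone. Positivity of `P 1` keeps away
from the base, where the bar below is attached and the wall disappears. -/
theorem IsWall.phi {n : ℕ} {P : Plane} {j : Fin 2} {σ : ℝ} (h : IsWall (table n) P j σ)
    (hy : 0 < P 1) (hx : -1 < P 0 ∧ P 0 < 2) (i : Fin 2) :
    IsWall (table (n + 1)) (phi i P) j σ := by
  have h1 : ∀ᶠ Q in 𝓝 P, 0 < Q 1 ∧ (-1 < Q 0 ∧ Q 0 < 2) :=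
    ((continuous_coord 1).continuousAt.eventually_const_lt hy).and
      (((continuous_coord 0).continuousAt.eventually_const_lt hx.1).and
        ((continuous_coord 0).continuousAt.eventually_lt_const hx.2))
  filter_upwards [(tendsto_phiInv i P).eventually (h.and h1)] with Q hQ
  obtain ⟨hw, hQy, hQx⟩ := hQ
  have h2 : 3 / 2 < Q 1 := by
    rw [← phi_phiInv i Q, phi_y]
    linarith
  rw [mem_table_succ_iff_phiInv h2 hQx, hw]
  have h3 : (phiInv i Q) j - P j = 2 * (Q j - _root_.phi i P j) := by
    simp [phiInv, _root_.phi]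
    ring
  constructor <;> intro h4 <;> nlinarith [congrArg (σ * ·) h3]

theorem phi_mem_interior {n : ℕ} {P : Plane} (h : P ∈ interior (table n)) (i : Fin 2) :
    phi i P ∈ interior (table (n + 1)) := by
  rw [mem_interior_iff_mem_nhds] at h ⊢
  filter_upwards [(tendsto_phiInv i P).eventually h] with Q hQ
  exact mem_table_succ.2 (Or.inr ⟨i, _, hQ, phi_phiInv i Q⟩)

/-! ### Words -/

theorem phiWord_cons (i : Fin 2) (w : List (Fin 2)) (P : Plane) :
    phiWord (i :: w) P = phi i (phiWord w P) := rfl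

theorem phiWord_concat (w : List (Fin 2)) (i : Fin 2) (P : Plane) :
    phiWord (w ++ [i]) P = phiWord w (phi i P) := by
  induction w with
  | nil => rfl
  | cons j w ih => rw [List.cons_append, phiWord_cons, ih, phiWord_cons]

theorem phiWord_sub (w : List (Fin 2)) (P Q : Plane) :
    phiWord w P - phiWord w Q = ((1 / 2 : ℝ) ^ w.length) • (P - Q) := by
  induction w with
  | nil => simp [phiWord]
  | cons i w ih =>
    rw [phiWord_cons, phiWord_cons, List.length_cons, pow_succ', mul_smul, ← ih, phi, phi]
    module

theorem phiWord_add_smul (w : List (Fin 2)) (P v : Plane) (t : ℝ) :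
    phiWord w (P + t • v) = phiWord w P + (t * (1 / 2 : ℝ) ^ w.length) • v := by
  rw [← sub_eq_iff_eq_add', phiWord_sub, add_sub_cancel_left, smul_smul, mul_comm]

theorem phiWord_y (w : List (Fin 2)) (P : Plane) :
    phiWord w P 1 = 3 + (P 1 - 3) * (1 / 2 : ℝ) ^ w.length := by
  induction w with
  | nil => simp [phiWord]
  | cons i w ih =>
    rw [phiWord_cons, phi_y, ih, List.length_cons, pow_succ]
    ring

theorem phiWord_y_pos (w : List (Fin 2)) {P : Plane} (h : 0 < P 1) : 0 < phiWord w P 1 := by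
  induction w with
  | nil => exact h
  | cons i w ih =>
    rw [phiWord_cons, phi_y]
    linarith

theorem phiWord_x_bounds (w : List (Fin 2)) {P : Plane} (h : -1 < P 0 ∧ P 0 < 2) :
    -1 < phiWord w P 0 ∧ phiWord w P 0 < 2 := by
  induction w with
  | nil => exact h
  | cons i w ih => exact phi_x_bounds i ih.1 ih.2

theorem eq_of_phiWord_eq {w w' : List (Fin 2)} (hw : w.length = w'.length) {P Q : Plane}
    (hP : -1 < P 0 ∧ P 0 < 2) (hQ : -1 < Q 0 ∧ Q 0 < 2) (h : phiWord w P = phiWord w' Q) :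
    P = Q := by
  induction w generalizing w' with
  | nil =>
    obtain rfl : w' = [] := List.length_eq_zero_iff.1 hw.symm
    exact h
  | cons i w ih =>
    cases w' with
    | nil => simp at hw
    | cons j w' =>
      exact ih (by simpa using hw)
        (eq_of_phi_eq (phiWord_x_bounds w hP) (phiWord_x_bounds w' hQ) h).2

theorem IsWall.phiWord {n : ℕ} {P : Plane} {j : Fin 2} {σ : ℝ} (h : IsWall (table n) P j σ)
    (hy : 0 < P 1) (hx : -1 < P 0 ∧ P 0 < 2) (w : List (Fin 2)) :
    IsWall (table (n + w.length)) (phiWord w P) j σ := by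
  induction w with
  | nil => exact h
  | cons i w ih => exact ih.phi (phiWord_y_pos w hy) (phiWord_x_bounds w hx) i

theorem phiWord_mem_interior {n : ℕ} {P : Plane} (h : P ∈ interior (table n))
    (w : List (Fin 2)) : phiWord w P ∈ interior (table (n + w.length)) := by
  induction w with
  | nil => exact h
  | cons i w ih => exact phi_mem_interior ih i

/-! ### The base and the removed segments -/

theorem mem_base_iff {P : Plane} : P ∈ base ↔ 0 ≤ P 0 ∧ P 0 ≤ 1 ∧ P 1 = 0 := by
  rw [base, segment_eq_image']
  constructor
  · rintro ⟨t, ht, rfl⟩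
    simpa using ht
  · rintro ⟨h0, h1, h2⟩
    refine ⟨P 0, ⟨h0, h1⟩, ?_⟩
    ext j
    fin_cases j <;> simp [h2]

theorem mem_removed_iff {n : ℕ} {P : Plane} :
    P ∈ removed n ↔ ∃ w : List (Fin 2), w.length = n ∧ ∃ i, ∃ Q ∈ base,
      phiWord w (phi i Q) = P := by
  simp only [removed, removedSegment, mem_iUnion, mem_ofPred_eq, exists_prop, mem_image]
  constructor
  · rintro ⟨w, hw, Q, hQ, rfl⟩
    rcases List.eq_nil_or_concat w with rfl | ⟨w, i, rfl⟩
    · simp at hw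
    · refine ⟨w, by simpa using hw, i, Q, hQ, ?_⟩
      rw [List.concat_eq_append, phiWord_concat]
  · rintro ⟨w, hw, i, Q, hQ, rfl⟩
    exact ⟨w ++ [i], by simpa using hw, Q, hQ, phiWord_concat w i Q⟩

/-- Points of a copy of `tableZero` that do not lie on top of its ends are not removed. -/
theorem phiWord_not_mem_removed {n : ℕ} {w : List (Fin 2)} (hw : w.length ≤ n) {P : Plane}
    (hx : -1 < P 0 ∧ P 0 < 2) (hP : P 1 < 3 / 2 ∨ P 1 = 3 / 2 ∧ 0 < P 0 ∧ P 0 < 1) :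
    phiWord w P ∉ removed n := by
  rw [mem_removed_iff]
  rintro ⟨w', rfl, i, Q, hQ, h⟩
  rw [mem_base_iff] at hQ
  have hy := congrArg (fun R : Plane => R 1) h
  simp only [phiWord_y, phi_y, hQ.2.2] at hy
  have hP' : P 1 ≤ 3 / 2 := by
    rcases hP with h | h
    · exact h.le
    · exact h.1.le
  have hpow : (1 / 2 : ℝ) ^ w'.length ≤ (1 / 2 : ℝ) ^ w.length :=
    pow_le_pow_of_le_one (by norm_num) (by norm_num) hw
  have hpos : 0 < (1 / 2 : ℝ) ^ w'.length := by positivity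
  have hpos' : 0 < (1 / 2 : ℝ) ^ w.length := by positivity
  -- Equal heights mean `(3 - P 1) * (1/2)^|w| = (3/2) * (1/2)^|w'|` with `3 - P 1 ≥ 3/2`, so a word
  -- `w` shorter than `w'` would put the point too low.
  have hlen : w'.length = w.length := by
    refine le_antisymm ?_ hw
    by_contra! hlt
    have := pow_lt_pow_right_of_lt_one₀ (by norm_num) (by norm_num : (1 / 2 : ℝ) < 1) hlt
    nlinarith
  have hQx : -1 < phi i Q 0 ∧ phi i Q 0 < 2 :=
    phi_x_bounds i (by linarith [hQ.1]) (by linarith [hQ.2.1])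
  obtain rfl := eq_of_phiWord_eq hlen hQx hx h
  rw [phi_y, hQ.2.2] at hP
  rcases hP with hP | ⟨-, hP⟩
  · linarith
  · fin_cases i
    · simp only [Fin.zero_eta, phi_zero_x] at hP
      linarith
    · simp only [Fin.mk_one, phi_one_x] at hP
      linarith

theorem phiWord_not_mem_base {w : List (Fin 2)} {P : Plane} (h : 0 < P 1) :
    phiWord w P ∉ base := by
  rw [mem_base_iff]
  rintro ⟨-, -, h1⟩
  exact (phiWord_y_pos w h).ne' h1

/-! ### The interior and the walls of the first copy -/

theorem mem_interior_table {n : ℕ} {a b : ℝ}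
    (h : (0 < a ∧ a < 1 ∧ 0 < b ∧ b < 3 / 2) ∨ (-1 / 2 < a ∧ a < 3 / 2 ∧ 1 < b ∧ b < 3 / 2)) :
    !₂[a, b] ∈ interior (table n) := by
  refine interior_mono (tableZero_subset n) (mem_interior_iff_mem_nhds.2 ?_)
  have h0 : Tendsto (fun P : Plane => P 0) (𝓝 !₂[a, b]) (𝓝 a) :=
    (continuous_coord 0).tendsto _
  have h1 : Tendsto (fun P : Plane => P 1) (𝓝 !₂[a, b]) (𝓝 b) :=
    (continuous_coord 1).tendsto _
  rcases h with ⟨h2, h3, h4, h5⟩ | ⟨h2, h3, h4, h5⟩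
  all_goals
    filter_upwards [h0.eventually_const_lt h2, h0.eventually_lt_const h3,
      h1.eventually_const_lt h4, h1.eventually_lt_const h5] with P h2 h3 h4 h5
  · rcases le_total (P 1) 1 with h | h
    · exact Or.inl ⟨⟨h2.le, h3.le⟩, h4.le, h⟩
    · exact Or.inr ⟨⟨by linarith, by linarith⟩, h, h5.le⟩
  · exact Or.inr ⟨⟨h2.le, h3.le⟩, h4.le, h5.le⟩

theorem phi_base_mem_interior {n : ℕ} (hn : 0 < n) (i : Fin 2) {a : ℝ} (h0 : 0 < a)
    (h1 : a < 1) : phi i !₂[a, 0] ∈ interior (table n) := by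
  obtain ⟨n, rfl⟩ := Nat.exists_eq_succ_of_ne_zero hn.ne'
  rw [mem_interior_iff_mem_nhds]
  have h2 : ∀ᶠ Q in 𝓝 (!₂[a, 0] : Plane), (0 < Q 0 ∧ Q 0 < 1) ∧ -1 < Q 1 ∧ Q 1 < 1 := by
    refine (((continuous_coord 0).continuousAt.eventually_const_lt ?_).and
      ((continuous_coord 0).continuousAt.eventually_lt_const ?_)).and
      (((continuous_coord 1).continuousAt.eventually_const_lt ?_).and
        ((continuous_coord 1).continuousAt.eventually_lt_const ?_)) <;> simp [h0, h1]
  filter_upwards [(tendsto_phiInv i _).eventually h2] with P hP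
  obtain ⟨⟨h3, h4⟩, h5, h6⟩ := hP
  -- Above the opening the stem of the small copy fills the neighbourhood, below it the bar of the
  -- first copy does.
  rcases le_total 0 (phiInv i P 1) with h | h
  · refine mem_table_succ.2 (Or.inr ⟨i, _, tableZero_subset n ?_, phi_phiInv i P⟩)
    exact Or.inl ⟨⟨h3.le, h4.le⟩, h, h6.le⟩
  · refine tableZero_subset _ (Or.inr ?_)
    rw [← phi_phiInv i P]
    refine ⟨?_, by rw [phi_y]; constructor <;> linarith⟩
    fin_cases i
    · simp only [Fin.zero_eta, phi_zero_x] at *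
      constructor <;> linarith
    · simp only [Fin.mk_one, phi_one_x] at *
      constructor <;> linarith

section Walls

variable {n : ℕ} {a b σ : ℝ}

theorem tendsto_x (a b : ℝ) : Tendsto (fun P : Plane => P 0) (𝓝 !₂[a, b]) (𝓝 a) :=
  (continuous_coord 0).tendsto _

theorem tendsto_y (a b : ℝ) : Tendsto (fun P : Plane => P 1) (𝓝 !₂[a, b]) (𝓝 b) :=
  (continuous_coord 1).tendsto _

theorem isWall_stem (hσ : σ = 1 ∨ σ = -1) (h0 : 0 < b) (h1 : b < 1) :
    IsWall (table n) !₂[1 / 2 + σ * (1 / 2), b] 0 σ := by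
  filter_upwards [(tendsto_y _ b).eventually_const_lt h0, (tendsto_y _ b).eventually_lt_const h1,
    (tendsto_x _ b).eventually (Ioo_mem_nhds (sub_one_lt _) (lt_add_one _))] with P h2 h3 h4
  rw [mem_table_iff (by linarith) (Or.inl (by linarith))]
  rcases hσ with rfl | rfl
  · constructor
    · intro h
      have := (tableZero_bounds h).2.2.2.2 h3
      simp
      linarith
    · intro h
      simp at h
      exact Or.inl ⟨⟨by linarith [h4.1], by linarith⟩, h2.le, h3.le⟩
  · constructor
    · intro h
      have := (tableZero_bounds h).2.2.2.2 h3
      simp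
      linarith
    · intro h
      simp at h
      exact Or.inl ⟨⟨by linarith, by linarith [h4.2]⟩, h2.le, h3.le⟩

theorem isWall_bar (hσ : σ = 1 ∨ σ = -1) (h0 : 1 < b) (h1 : b < 3 / 2) :
    IsWall (table n) !₂[1 / 2 + σ, b] 0 σ := by
  filter_upwards [(tendsto_y _ b).eventually_const_lt h0, (tendsto_y _ b).eventually_lt_const h1,
    (tendsto_x _ b).eventually (Ioo_mem_nhds (sub_one_lt _) (lt_add_one _))] with P h2 h3 h4
  rw [mem_table_iff (by linarith) (Or.inl (by linarith))]
  rcases hσ with rfl | rfl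
  · constructor
    · rintro (h | h)
      · exact absurd h.2.2 (not_le.2 h2)
      · have := h.1.2
        simp
        linarith
    · intro h
      simp at h
      exact Or.inr ⟨⟨by linarith [h4.1], by linarith⟩, h2.le, h3.le⟩
  · constructor
    · rintro (h | h)
      · exact absurd h.2.2 (not_le.2 h2)
      · have := h.1.1
        simp
        linarith
    · intro h
      simp at h
      exact Or.inr ⟨⟨by linarith, by linarith [h4.2]⟩, h2.le, h3.le⟩

theorem isWall_floor (h : -1 / 2 < a ∧ a < 0 ∨ 1 < a ∧ a < 3 / 2) :
    IsWall (table n) !₂[a, 1] 1 (-1) := by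
  have h0 : ∀ᶠ P in 𝓝 (!₂[a, 1] : Plane),
      -1 / 2 < P 0 ∧ P 0 < 0 ∨ 1 < P 0 ∧ P 0 < 3 / 2 := by
    rcases h with h | h
    · filter_upwards [(tendsto_x a 1).eventually (Ioo_mem_nhds h.1 h.2)] with P hP using Or.inl hP
    · filter_upwards [(tendsto_x a 1).eventually (Ioo_mem_nhds h.1 h.2)] with P hP using Or.inr hP
  filter_upwards [h0, (tendsto_y a 1).eventually_lt_const (by norm_num : (1 : ℝ) < 3 / 2)]
    with P h1 h2
  rw [mem_table_iff (by linarith) (Or.inl h2.le)]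
  constructor
  · rintro (⟨h3, -⟩ | h3)
    · exfalso
      rcases h1 with h1 | h1
      · linarith [h3.1]
      · linarith [h3.2]
    · simpa using h3.2.1
  · intro h3
    simp at h3
    refine Or.inr ⟨?_, h3, h2.le⟩
    rcases h1 with h1 | h1 <;> constructor <;> linarith

theorem isWall_ceiling (h0 : 0 < a) (h1 : a < 1) : IsWall (table n) !₂[a, 3 / 2] 1 1 := by
  filter_upwards [(tendsto_x a (3 / 2)).eventually (Ioo_mem_nhds h0 h1),
    (tendsto_y a (3 / 2)).eventually (Ioo_mem_nhds (by norm_num : (1 : ℝ) < 3 / 2)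
      (by norm_num : (3 / 2 : ℝ) < 2))] with P h2 h3
  rw [mem_table_iff h3.2 (Or.inr h2)]
  constructor
  · intro h
    simpa using (tableZero_bounds h).2.1
  · intro h
    simp at h
    exact Or.inr ⟨⟨by linarith [h2.1], by linarith [h2.2]⟩, h3.1.le, h⟩

/-- Level 0 only: from level 1 on this segment is an opening (`phi_base_mem_interior`). Transport by
a word of length `n` gives the walls through which the ball escapes from `table n`. -/
theorem isWall_removed (i : Fin 2) (h0 : 0 < a) (h1 : a < 1) :
    IsWall (table 0) (phi i !₂[a, 0]) 1 1 := by
  have h2 : ∀ᶠ Q in 𝓝 (!₂[a, 0] : Plane), (0 < Q 0 ∧ Q 0 < 1) ∧ -1 < Q 1 :=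
    ((tendsto_x a 0).eventually (Ioo_mem_nhds h0 h1)).and
      ((tendsto_y a 0).eventually_const_lt (by norm_num))
  filter_upwards [(tendsto_phiInv i _).eventually h2] with P hP
  obtain ⟨⟨h3, h4⟩, h5⟩ := hP
  obtain ⟨Q, rfl⟩ : ∃ Q, phi i Q = P := ⟨_, phi_phiInv i P⟩
  rw [phiInv_phi] at h3 h4 h5
  rw [table_zero, phi_y, phi_y]
  constructor
  · intro h
    have := (tableZero_bounds h).2.1
    rw [phi_y] at this
    simp
    linarith
  · intro h
    simp at h
    refine Or.inr ⟨?_, by rw [phi_y]; constructor <;> linarith⟩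
    fin_cases i
    · simp only [Fin.zero_eta, phi_zero_x]
      constructor <;> linarith
    · simp only [Fin.mk_one, phi_one_x]
      constructor <;> linarith

end Walls

/-! ### Motion inside a copy of the table -/

/-- The velocity with slope `1 / p`, horizontal sign `ε`, vertical sign `δ` and vertical
speed `s`. -/
noncomputable def velocity (p s ε δ : ℝ) : Plane := !₂[ε * (p * s), δ * s]

section Cell

variable {n : ℕ} {S : Set Plane} {a : Plane × Plane} {w : List (Fin 2)} {p s ε δ : ℝ}

/-- The flight is parametrised by the height gained in the coordinates of the unscaled `T`; the time
spent is this height divided by `s` and scaled by `(1/2)^|w|`. -/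
theorem Passes.move {Ω : Set Plane} (hs : 0 < s) {x y h : ℝ} (hh : 0 < h)
    (hP : Passes Ω S a (phiWord w !₂[x, y]) (velocity p s ε δ))
    (hint : ∀ r ∈ Ioo 0 h, phiWord w !₂[x + ε * (p * r), y + δ * r] ∈ interior Ω) :
    Arrives Ω S a (phiWord w !₂[x + ε * (p * h), y + δ * h]) (velocity p s ε δ) := by
  have hpow : 0 < (1 / 2 : ℝ) ^ w.length := by positivity
  have key : ∀ r : ℝ, phiWord w !₂[x + ε * (p * r), y + δ * r] =
      phiWord w !₂[x, y] + (r / s * (1 / 2 : ℝ) ^ w.length) • velocity p s ε δ := by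
    intro r
    rw [← phiWord_add_smul]
    congr 1
    ext j
    fin_cases j <;> (simp [velocity]; field_simp)
  rw [key]
  refine hP.arrives (by positivity) fun r hr => ?_
  have h1 := hint (r * s / (1 / 2 : ℝ) ^ w.length) ⟨by have := hr.1; positivity, ?_⟩
  · rw [key] at h1
    convert h1 using 3
    field_simp
  · rw [div_lt_iff₀ hpow]
    have := mul_lt_mul_of_pos_right hr.2 hs
    calc r * s < h / s * (1 / 2 : ℝ) ^ w.length * s := this
      _ = h * (1 / 2 : ℝ) ^ w.length := by field_simp

theorem Arrives.reflect_vertical {Ω : Set Plane} {q : Plane} (hp : 0 < p) (hs : 0 < s)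
    (hε : ε = 1 ∨ ε = -1) (hA : Arrives Ω S a q (velocity p s ε δ)) (hw : IsWall Ω q 0 ε)
    (hq : q ∉ S) : Passes Ω S a q (velocity p s (-ε) δ) := by
  have h1 := hA.reflect hw (by
    have : 0 < p * s := by positivity
    rcases hε with rfl | rfl <;> simpa [velocity] using this) hq
  rwa [velocity, axisReflection_zero, ← neg_mul] at h1

theorem Arrives.reflect_horizontal {Ω : Set Plane} {q : Plane} (hs : 0 < s)
    (hδ : δ = 1 ∨ δ = -1) (hA : Arrives Ω S a q (velocity p s ε δ)) (hw : IsWall Ω q 1 δ)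
    (hq : q ∉ S) : Passes Ω S a q (velocity p s ε (-δ)) := by
  have h1 := hA.reflect hw (by rcases hδ with rfl | rfl <;> simpa [velocity] using hs) hq
  rwa [velocity, axisReflection_one, ← neg_mul] at h1

/-- The copy under `phiWord w` of a vertical strip of width `L` around the axis of symmetry, at
heights between `lo` and `hi`, is contained in `Ω` and bounded by vertical walls outside `S`. -/
structure IsStrip (Ω S : Set Plane) (w : List (Fin 2)) (L lo hi : ℝ) : Prop where
  interior : ∀ x y, lo < y → y < hi → 1 / 2 - L / 2 < x → x < 1 / 2 + L / 2 →
    phiWord w !₂[x, y] ∈ _root_.interior Ω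
  wall : ∀ σ y, σ = 1 ∨ σ = -1 → lo < y → y < hi →
    IsWall Ω (phiWord w !₂[1 / 2 + σ * (L / 2), y]) 0 σ
  not_mem : ∀ σ y, σ = 1 ∨ σ = -1 → lo < y → y < hi →
    phiWord w !₂[1 / 2 + σ * (L / 2), y] ∉ S

/-- The motion through a strip with `m` collisions. The numbers `u` and `r` are the distances from
the wall behind the ball, before and after. -/
theorem IsStrip.traverse {Ω : Set Plane} {L lo hi : ℝ} (hI : IsStrip Ω S w L lo hi) (hp : 0 < p)
    (hs : 0 < s) (m : ℕ) {u r h y : ℝ} (hε : ε = 1 ∨ ε = -1) (hu0 : 0 ≤ u) (huL : u < L)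
    (hr0 : 0 < r) (hrL : r < L) (hh : 0 < h) (hm : u + p * h = m * L + r)
    (hy : ∀ t ∈ Ioo 0 h, lo < y + δ * t ∧ y + δ * t < hi)
    (hP : Passes Ω S a (phiWord w !₂[1 / 2 + ε * (u - L / 2), y]) (velocity p s ε δ)) :
    Arrives Ω S a (phiWord w !₂[1 / 2 + ε * (-1) ^ m * (r - L / 2), y + δ * h])
      (velocity p s (ε * (-1) ^ m) δ) := by
  have hseg : ∀ t, 0 < t → t ≤ h → u + p * t ≤ L → ∀ t' ∈ Ioo 0 t,
      phiWord w !₂[1 / 2 + ε * (u - L / 2) + ε * (p * t'), y + δ * t'] ∈ _root_.interior Ω := by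
    intro t ht hth htL t' ht'
    obtain ⟨h1, h2⟩ := hy t' ⟨ht'.1, by linarith [ht'.2]⟩
    have h3 : 0 < p * t' := mul_pos hp ht'.1
    have h4 : p * t' < p * t := mul_lt_mul_of_pos_left ht'.2 hp
    refine hI.interior _ _ h1 h2 ?_ ?_ <;> rcases hε with rfl | rfl <;> linarith
  induction m generalizing ε u h y with
  | zero =>
    simp only [Nat.cast_zero, zero_mul, zero_add] at hm
    have h1 := hP.move hs hh (hseg h hh le_rfl (by linarith))
    have hx : 1 / 2 + ε * (u - L / 2) + ε * (p * h) = 1 / 2 + ε * (r - L / 2) := by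
      rw [← hm]
      ring
    rwa [hx, ← mul_one ε, ← pow_zero (-1 : ℝ)] at h1
  | succ m ih =>
    rw [Nat.cast_succ] at hm
    -- The height covered before the next bounce, after which the ball starts at distance 0 from the
    -- wall behind it.
    set t := (L - u) / p with htdef
    have ht : 0 < t := div_pos (by linarith) hp
    have hpt : p * t = L - u := by
      rw [htdef]
      field_simp
    have hmL : 0 ≤ (m : ℝ) * L := by
      have : 0 < L := by linarith
      positivity
    have hth : t < h := by
      by_contra! hle
      have := mul_le_mul_of_nonneg_left hle hp.le
      linarith
    have h1 := hP.move hs ht (hseg t ht hth.le (by linarith))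
    have hx : 1 / 2 + ε * (u - L / 2) + ε * (p * t) = 1 / 2 + ε * (L / 2) := by
      rw [hpt]
      ring
    rw [hx] at h1
    obtain ⟨h2, h3⟩ := hy t ⟨ht, hth⟩
    have h4 := h1.reflect_vertical hp hs hε (hI.wall ε _ hε h2 h3) (hI.not_mem ε _ hε h2 h3)
    have hy' : ∀ t' ∈ Ioo 0 (h - t), lo < y + δ * t + δ * t' ∧ y + δ * t + δ * t' < hi := by
      intro t' ht'
      have := hy (t + t') ⟨by linarith [ht'.1], by linarith [ht'.2]⟩
      rwa [mul_add, ← add_assoc] at this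
    have hε' : -ε = 1 ∨ -ε = -1 := by
      rcases hε with rfl | rfl <;> simp
    have h5 := ih (ε := -ε) (u := 0) (h := h - t) (y := y + δ * t) hε' le_rfl (by linarith)
      (by linarith) (by rw [mul_sub, hpt]; linarith) hy'
      (by convert h4 using 5; ring) (by
        intro τ hτ hτh hτL t' ht'
        obtain ⟨h1, h2⟩ := hy' t' ⟨ht'.1, by linarith [ht'.2]⟩
        have h3 : 0 < p * t' := mul_pos hp ht'.1
        have h4 : p * t' < p * τ := mul_lt_mul_of_pos_left ht'.2 hp
        refine hI.interior _ _ h1 h2 ?_ ?_ <;> rcases hε with rfl | rfl <;> linarith)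
    have hsign : -ε * (-1) ^ m = ε * (-1) ^ (m + 1) := by ring
    rw [hsign] at h5
    convert h5 using 5
    ring

theorem isStrip_stem (hw : w.length ≤ n) :
    IsStrip (table n) (base ∪ removed n) w 1 0 1 := by
  obtain ⟨m, rfl⟩ := Nat.exists_eq_add_of_le' hw
  refine ⟨fun x y h0 h1 hx0 hx1 => ?_, fun σ y hσ h0 h1 => ?_, fun σ y hσ h0 h1 => ?_⟩
  · exact phiWord_mem_interior (mem_interior_table
      (Or.inl ⟨by linarith, by linarith, h0, by linarith⟩)) w
  · refine (isWall_stem hσ h0 h1).phiWord h0 ?_ w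
    rcases hσ with rfl | rfl <;> (simp; try norm_num)
  · rintro (h | h)
    · exact phiWord_not_mem_base (by simpa using h0) h
    · refine phiWord_not_mem_removed hw ?_ (Or.inl ?_) h
      · rcases hσ with rfl | rfl <;> (simp; try norm_num)
      · simp
        linarith

theorem isStrip_bar (hw : w.length ≤ n) :
    IsStrip (table n) (base ∪ removed n) w 2 1 (3 / 2) := by
  obtain ⟨m, rfl⟩ := Nat.exists_eq_add_of_le' hw
  refine ⟨fun x y h0 h1 hx0 hx1 => ?_, fun σ y hσ h0 h1 => ?_, fun σ y hσ h0 h1 => ?_⟩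
  · exact phiWord_mem_interior (mem_interior_table
      (Or.inr ⟨by linarith, by linarith, h0, h1⟩)) w
  · rw [div_self two_ne_zero, mul_one]
    refine (isWall_bar hσ h0 h1).phiWord (by simp; linarith) ?_ w
    rcases hσ with rfl | rfl <;> (simp; try norm_num)
  · rintro (h | h)
    · exact phiWord_not_mem_base (by simp; linarith) h
    · refine phiWord_not_mem_removed hw ?_ (Or.inl ?_) h
      · rcases hσ with rfl | rfl <;> (simp; try norm_num)
      · simpa using h1

/-! ### Crossing the stem and the bar -/

/-- Over height 1 the sideways motion is exactly `p` widths, hence `p` bounces and the same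
remainder `u`. Oddness of `p` reverses the direction, and the position is mirrored with it. -/
theorem traverse_stem {p : ℕ} (hp : Odd p) (hs : 0 < s) (hw : w.length ≤ n)
    (hε : ε = 1 ∨ ε = -1) {u : ℝ} (h0 : 0 < u) (h1 : u < 1)
    (hP : Passes (table n) (base ∪ removed n) a (phiWord w !₂[1 / 2 + ε * (u - 1 / 2), 0])
      (velocity p s ε 1)) :
    Passes (table n) (base ∪ removed n) a (phiWord w !₂[1 / 2 + -ε * (u - 1 / 2), 1])
      (velocity p s (-ε) 1) := by
  have hp0 : (0 : ℝ) < p := by exact_mod_cast hp.pos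
  have h := (isStrip_stem hw).traverse hp0 hs p hε h0.le h1 h0 h1 one_pos (by ring)
    (fun t ht => by simpa using ht) hP
  rw [hp.neg_one_pow, mul_neg_one, zero_add, one_mul] at h
  obtain ⟨m, rfl⟩ := Nat.exists_eq_add_of_le' hw
  refine h.passes (phiWord_mem_interior (mem_interior_table (Or.inl ⟨?_, ?_, ?_, ?_⟩)) w)
  all_goals rcases hε with rfl | rfl <;> linarith

/-- Height 1/2 means `p / 2` sideways; `hm` divides the distance travelled by the bar width 2, with
the number of bounces as quotient. -/
theorem traverse_bar_up {p : ℝ} (hp : 0 < p) (hs : 0 < s) (hw : w.length ≤ n)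
    (hε : ε = 1 ∨ ε = -1) (m : ℕ) {u r : ℝ} (h0 : 0 < u) (h1 : u < 2) (hr0 : 0 < r) (hr1 : r < 2)
    (hm : u + p / 2 = m * 2 + r)
    (hP : Passes (table n) (base ∪ removed n) a (phiWord w !₂[1 / 2 + ε * (u - 1), 1])
      (velocity p s ε 1)) :
    Arrives (table n) (base ∪ removed n) a
      (phiWord w !₂[1 / 2 + ε * (-1) ^ m * (r - 1), 3 / 2])
      (velocity p s (ε * (-1) ^ m) 1) := by
  have h := (isStrip_bar hw).traverse (y := 1) (δ := 1) hp hs m hε h0.le h1 hr0 hr1 one_half_pos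
    (by rw [← hm]; ring)
    (fun t ht => by constructor <;> linarith [ht.1, ht.2])
    (by rwa [div_self two_ne_zero])
  rw [div_self two_ne_zero] at h
  convert h using 5
  norm_num

theorem traverse_bar_down {p : ℝ} (hp : 0 < p) (hs : 0 < s) (hw : w.length ≤ n)
    (hε : ε = 1 ∨ ε = -1) (m : ℕ) {u r : ℝ} (h0 : 0 < u) (h1 : u < 2) (hr0 : 0 < r) (hr1 : r < 2)
    (hm : u + p / 2 = m * 2 + r)
    (hP : Passes (table n) (base ∪ removed n) a (phiWord w !₂[1 / 2 + ε * (u - 1), 3 / 2])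
      (velocity p s ε (-1))) :
    Arrives (table n) (base ∪ removed n) a
      (phiWord w !₂[1 / 2 + ε * (-1) ^ m * (r - 1), 1])
      (velocity p s (ε * (-1) ^ m) (-1)) := by
  have h := (isStrip_bar hw).traverse (y := 3 / 2) (δ := -1) hp hs m hε h0.le h1 hr0 hr1 one_half_pos
    (by rw [← hm]; ring)
    (fun t ht => by constructor <;> linarith [ht.1, ht.2])
    (by rwa [div_self two_ne_zero])
  rw [div_self two_ne_zero] at h
  convert h using 5
  norm_num

theorem Arrives.reflect_ceiling (hs : 0 < s) (hw : w.length ≤ n) {x : ℝ} (h0 : 0 < x) (h1 : x < 1)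
    (hA : Arrives (table n) (base ∪ removed n) a (phiWord w !₂[x, 3 / 2]) (velocity p s ε 1)) :
    Passes (table n) (base ∪ removed n) a (phiWord w !₂[x, 3 / 2]) (velocity p s ε (-1)) := by
  have hx : -1 < (!₂[x, 3 / 2] : Plane) 0 ∧ (!₂[x, 3 / 2] : Plane) 0 < 2 := by
    constructor <;> simp <;> linarith
  have hy : 0 < (!₂[x, 3 / 2] : Plane) 1 := by simp
  refine hA.reflect_horizontal hs (Or.inl rfl) ?_ ?_
  · obtain ⟨m, rfl⟩ := Nat.exists_eq_add_of_le' hw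
    exact (isWall_ceiling h0 h1).phiWord hy hx w
  · rintro (h | h)
    · exact phiWord_not_mem_base hy h
    · exact phiWord_not_mem_removed hw hx (Or.inr ⟨by simp, h0, h1⟩) h

theorem Arrives.reflect_floor (hs : 0 < s) (hw : w.length ≤ n) {x : ℝ}
    (h : -1 / 2 < x ∧ x < 0 ∨ 1 < x ∧ x < 3 / 2)
    (hA : Arrives (table n) (base ∪ removed n) a (phiWord w !₂[x, 1]) (velocity p s ε (-1))) :
    Passes (table n) (base ∪ removed n) a (phiWord w !₂[x, 1]) (velocity p s ε 1) := by
  have hx : -1 < (!₂[x, 1] : Plane) 0 ∧ (!₂[x, 1] : Plane) 0 < 2 := by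
    rcases h with h | h <;> constructor <;> simp <;> linarith
  have hy : 0 < (!₂[x, 1] : Plane) 1 := by simp
  have h1 := hA.reflect_horizontal hs (Or.inr rfl) (q := phiWord w !₂[x, 1]) ?_ ?_
  · rwa [neg_neg] at h1
  · obtain ⟨m, rfl⟩ := Nat.exists_eq_add_of_le' hw
    exact (isWall_floor h).phiWord hy hx w
  · rintro (h | h)
    · exact phiWord_not_mem_base hy h
    · exact phiWord_not_mem_removed hw hx (Or.inl (by simp; norm_num)) h

/-! ### The doubling map on a single copy -/

theorem mul_neg_one_pow_sign (hε : ε = 1 ∨ ε = -1) (m : ℕ) :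
    ε * (-1) ^ m = 1 ∨ ε * (-1) ^ m = -1 := by
  rcases hε with rfl | rfl <;> rcases neg_one_pow_eq_or ℝ m with h | h <;> simp [h]

/-- Coordinates of the upper segment behind the ball, which is the base of a smaller copy. -/
theorem exists_phi_back (hε : ε = 1 ∨ ε = -1) (u : ℝ) :
    ∃ i, !₂[1 / 2 + ε * (u - 1), 3 / 2] = phi i !₂[1 / 2 + ε * (2 * u - 1 / 2), 0] := by
  rcases hε with rfl | rfl
  · refine ⟨1, ?_⟩
    ext j
    fin_cases j
    · simp only [Fin.zero_eta, phi_one_x]; simp; ring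
    · simp only [Fin.mk_one, phi_y]; simp
  · refine ⟨0, ?_⟩
    ext j
    fin_cases j
    · simp only [Fin.zero_eta, phi_zero_x]; simp; ring
    · simp only [Fin.mk_one, phi_y]; simp

/-- Coordinates of the upper segment in front of the ball, which is the base of a smaller copy. -/
theorem exists_phi_front (hε : ε = 1 ∨ ε = -1) (u : ℝ) :
    ∃ i, !₂[1 / 2 + ε * (u + 1 - 1), 3 / 2] = phi i !₂[1 / 2 + ε * (2 * u - 1 - 1 / 2), 0] := by
  rcases hε with rfl | rfl
  · refine ⟨0, ?_⟩
    ext j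
    fin_cases j
    · simp only [Fin.zero_eta, phi_zero_x]; simp; ring
    · simp only [Fin.mk_one, phi_y]; simp
  · refine ⟨1, ?_⟩
    ext j
    fin_cases j
    · simp only [Fin.zero_eta, phi_one_x]; simp; ring
    · simp only [Fin.mk_one, phi_y]; simp

/-- A ball that enters a copy of the table leaves it through the base of a smaller copy, and the
distance from the endpoint behind it changes by the doubling map. -/
theorem traverse_copy {p : ℕ} (hp : Odd p) (hs : 0 < s) (hw : w.length ≤ n)
    (hε : ε = 1 ∨ ε = -1) {u : ℝ} (h0 : 0 < u) (h1 : u < 1) (hu : u ≠ 1 / 2)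
    (hP : Passes (table n) (base ∪ removed n) a (phiWord w !₂[1 / 2 + ε * (u - 1 / 2), 0])
      (velocity p s ε 1)) :
    ∃ ε' i, (ε' = 1 ∨ ε' = -1) ∧ Arrives (table n) (base ∪ removed n) a
      (phiWord w (phi i !₂[1 / 2 + ε' * (Int.fract (2 * u) - 1 / 2), 0])) (velocity p s ε' 1) := by
  have hp0 : (0 : ℝ) < p := by exact_mod_cast hp.pos
  have hA := traverse_stem hp hs hw hε h0 h1 hP
  have hε₁ : -ε = 1 ∨ -ε = -1 := by
    rcases hε with rfl | rfl <;> simp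
  -- The bar wall behind the ball is 1/2 further away than the stem wall.
  have hx : u - 1 / 2 = u + 1 / 2 - 1 := by ring
  rw [hx] at hA
  have hback : ∀ ε', (ε' = 1 ∨ ε' = -1) → u < 1 / 2 →
      Arrives (table n) (base ∪ removed n) a (phiWord w !₂[1 / 2 + ε' * (u - 1), 3 / 2])
        (velocity p s ε' 1) → ∃ ε' i, (ε' = 1 ∨ ε' = -1) ∧
        Arrives (table n) (base ∪ removed n) a
          (phiWord w (phi i !₂[1 / 2 + ε' * (Int.fract (2 * u) - 1 / 2), 0]))
          (velocity p s ε' 1) := by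
    intro ε' hε' hlt h
    obtain ⟨i, hi⟩ := exists_phi_back hε' u
    refine ⟨ε', i, hε', ?_⟩
    rwa [Int.fract_eq_self.2 ⟨by linarith, by linarith⟩, ← hi]
  have hfront : ∀ ε', (ε' = 1 ∨ ε' = -1) → 1 / 2 < u →
      Arrives (table n) (base ∪ removed n) a (phiWord w !₂[1 / 2 + ε' * (u + 1 - 1), 3 / 2])
        (velocity p s ε' 1) → ∃ ε' i, (ε' = 1 ∨ ε' = -1) ∧
        Arrives (table n) (base ∪ removed n) a
          (phiWord w (phi i !₂[1 / 2 + ε' * (Int.fract (2 * u) - 1 / 2), 0]))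
          (velocity p s ε' 1) := by
    intro ε' hε' hlt h
    obtain ⟨i, hi⟩ := exists_phi_front hε' u
    refine ⟨ε', i, hε', ?_⟩
    have : Int.fract (2 * u) = 2 * u - 1 :=
      Int.fract_eq_iff.2 ⟨by linarith, by linarith, 1, by simp⟩
    rwa [this, ← hi]
  -- The class of `p` modulo 4 determines `p / 2` modulo the bar width 2.
  obtain ⟨q, hq | hq⟩ : ∃ q : ℕ, p = 4 * q + 1 ∨ p = 4 * q + 3 := by
    obtain ⟨k, hk⟩ := hp
    exact ⟨k / 2, by omega⟩
  · have hpq : (p : ℝ) = 4 * q + 1 := by exact_mod_cast hq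
    have hB := traverse_bar_up hp0 hs hw hε₁ q (r := u + 1) (by linarith) (by linarith)
      (by linarith) (by linarith) (by rw [hpq]; ring) hA
    have hε₂ := mul_neg_one_pow_sign hε₁ q
    set ε₂ := -ε * (-1) ^ q
    rcases lt_or_gt_of_ne hu with hlt | hgt
    -- Here `1 < u + 1 < 3/2`, in the middle of the ceiling. The next distances are `u + 3/2` on the
    -- floor and, after one more wrap around the bar, `u` on top.
    · have hC := hB.reflect_ceiling hs hw
        (by rcases hε₂ with h | h <;> rw [h] <;> linarith)
        (by rcases hε₂ with h | h <;> rw [h] <;> linarith)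
      have hD := traverse_bar_down hp0 hs hw hε₂ q (r := u + 3 / 2) (by linarith) (by linarith)
        (by linarith) (by linarith) (by rw [hpq]; ring) hC
      have hε₃ := mul_neg_one_pow_sign hε₂ q
      set ε₃ := ε₂ * (-1) ^ q
      have hE := hD.reflect_floor hs hw (by
        rcases hε₃ with h | h <;> rw [h]
        · right
          constructor <;> linarith
        · left
          constructor <;> linarith)
      exact hback _ (mul_neg_one_pow_sign hε₃ (q + 1)) hlt
        (traverse_bar_up hp0 hs hw hε₃ (q + 1) (by linarith) (by linarith) h0 (by linarith)
          (by rw [hpq]; push_cast; ring) hE)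
    · exact hfront _ hε₂ hgt hB
  · have hpq : (p : ℝ) = 4 * q + 3 := by exact_mod_cast hq
    have hB := traverse_bar_up hp0 hs hw hε₁ (q + 1) (r := u) (by linarith) (by linarith)
      (by linarith) (by linarith) (by rw [hpq]; push_cast; ring) hA
    have hε₂ := mul_neg_one_pow_sign hε₁ (q + 1)
    set ε₂ := -ε * (-1) ^ (q + 1)
    rcases lt_or_gt_of_ne hu with hlt | hgt
    · exact hback _ hε₂ hlt hB
    -- Here `1/2 < u < 1`, again the middle of the ceiling. The next distances are `u - 1/2` on the
    -- floor and `u + 1` on top.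
    · have hC := hB.reflect_ceiling hs hw
        (by rcases hε₂ with h | h <;> rw [h] <;> linarith)
        (by rcases hε₂ with h | h <;> rw [h] <;> linarith)
      have hD := traverse_bar_down hp0 hs hw hε₂ (q + 1) (r := u - 1 / 2) (by linarith)
        (by linarith) (by linarith) (by linarith) (by rw [hpq]; push_cast; ring) hC
      have hε₃ := mul_neg_one_pow_sign hε₂ (q + 1)
      set ε₃ := ε₂ * (-1) ^ (q + 1)
      have hE := hD.reflect_floor hs hw (by
        rcases hε₃ with h | h <;> rw [h]
        · left
          constructor <;> linarith
        · right
          constructor <;> linarith)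
      exact hfront _ (mul_neg_one_pow_sign hε₃ q) hgt
        (traverse_bar_up hp0 hs hw hε₃ q (by linarith) (by linarith) (by linarith) (by linarith)
          (by rw [hpq]; ring) hE)

end Cell

/-! ### The escape -/

section Escape

variable {u : ℝ}

/-- The values 0 and 1/2 would make `2^j * u` or `2^(j+1) * u` an integer. They are the ones for
which the ball would meet an end of a base or of a removed segment. -/
theorem fract_pow_bounds (hu : ∀ (j : ℕ) (z : ℤ), (2 : ℝ) ^ j * u ≠ z) (j : ℕ) :
    0 < Int.fract ((2 : ℝ) ^ j * u) ∧ Int.fract ((2 : ℝ) ^ j * u) < 1 ∧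
      Int.fract ((2 : ℝ) ^ j * u) ≠ 1 / 2 := by
  refine ⟨Int.fract_pos.2 (hu j _), Int.fract_lt_one _, fun h => ?_⟩
  refine hu (j + 1) (2 * ⌊(2 : ℝ) ^ j * u⌋ + 1) ?_
  rw [Int.fract] at h
  push_cast
  rw [pow_succ]
  linarith

theorem fract_two_mul_fract (y : ℝ) : Int.fract (2 * Int.fract y) = Int.fract (2 * y) := by
  rw [Int.fract_eq_fract]
  refine ⟨-(2 * ⌊y⌋), ?_⟩
  rw [Int.fract]
  push_cast
  ring

variable {p n : ℕ} {s ε : ℝ} {a : Plane × Plane}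

/-- Iterates `traverse_copy`. The word is extended on the right, since each opening leads into a
copy attached to the current one. -/
theorem passes_copy (hp : Odd p) (hs : 0 < s) (hε : ε = 1 ∨ ε = -1)
    (hu : ∀ (j : ℕ) (z : ℤ), (2 : ℝ) ^ j * u ≠ z) (h0 : 0 < u) (h1 : u < 1)
    (ha : a = (!₂[1 / 2 + ε * (u - 1 / 2), 0], velocity p s ε 1)) {j : ℕ} (hj : j ≤ n) :
    ∃ (w : List (Fin 2)) (ε' : ℝ), w.length = j ∧ (ε' = 1 ∨ ε' = -1) ∧
      Passes (table n) (base ∪ removed n) a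
        (phiWord w !₂[1 / 2 + ε' * (Int.fract ((2 : ℝ) ^ j * u) - 1 / 2), 0])
        (velocity p s ε' 1) := by
  induction j with
  | zero =>
    refine ⟨[], ε, rfl, hε, ?_⟩
    rw [pow_zero, one_mul, Int.fract_eq_self.2 ⟨h0.le, h1⟩]
    have := Passes.refl (table n) (base ∪ removed n) a
    rw [ha] at this ⊢
    exact this
  | succ j ih =>
    obtain ⟨w, ε', rfl, hε', hP⟩ := ih (by omega)
    obtain ⟨h2, h3, h4⟩ := fract_pow_bounds hu w.length
    obtain ⟨ε₂, i, hε₂, hA⟩ := traverse_copy hp hs (by omega) hε' h2 h3 h4 hP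
    rw [fract_two_mul_fract, ← mul_assoc, ← pow_succ'] at hA
    refine ⟨w ++ [i], ε₂, by simp, hε₂, ?_⟩
    rw [phiWord_concat]
    obtain ⟨h5, h6, -⟩ := fract_pow_bounds hu (w.length + 1)
    refine hA.passes ?_
    obtain ⟨m, rfl⟩ := Nat.exists_eq_add_of_le' (show w.length ≤ n by omega)
    refine phiWord_mem_interior (phi_base_mem_interior (by omega) i ?_ ?_) w
    all_goals rcases hε₂ with rfl | rfl <;> linarith

/-- After `n` openings the ball is in a copy of the last generation; there the exit of
`traverse_copy` is a wall, and the collision with it is the escape. -/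
theorem escapesAtDistance (hp : Odd p) (hs : 0 < s) (hε : ε = 1 ∨ ε = -1)
    (hu : ∀ (j : ℕ) (z : ℤ), (2 : ℝ) ^ j * u ≠ z) (h0 : 0 < u) (h1 : u < 1)
    (ha : a = (!₂[1 / 2 + ε * (u - 1 / 2), 0], velocity p s ε 1)) (n : ℕ) :
    EscapesAtDistance n a (u - binaryTrunc (n + 1) u) := by
  have hp0 : (0 : ℝ) < p := by exact_mod_cast hp.pos
  obtain ⟨w, ε', rfl, hε', hP⟩ := passes_copy (n := n) hp hs hε hu h0 h1 ha le_rfl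
  obtain ⟨h2, h3, h4⟩ := fract_pow_bounds hu w.length
  obtain ⟨ε₂, i, hε₂, hA⟩ := traverse_copy hp hs le_rfl hε' h2 h3 h4 hP
  rw [fract_two_mul_fract, ← mul_assoc, ← pow_succ'] at hA
  obtain ⟨h5, h6, -⟩ := fract_pow_bounds hu (w.length + 1)
  set r := Int.fract ((2 : ℝ) ^ (w.length + 1) * u) with hr
  have hx0 : 0 < 1 / 2 + ε₂ * (r - 1 / 2) := by
    rcases hε₂ with rfl | rfl <;> linarith
  have hx1 : 1 / 2 + ε₂ * (r - 1 / 2) < 1 := by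
    rcases hε₂ with rfl | rfl <;> linarith
  set x := 1 / 2 + ε₂ * (r - 1 / 2) with hx
  obtain ⟨hy, hxb⟩ : 0 < phi i !₂[x, 0] 1 ∧ -1 < phi i !₂[x, 0] 0 ∧ phi i !₂[x, 0] 0 < 2 := by
    refine ⟨by rw [phi_y]; simp, phi_x_bounds i ?_ ?_⟩ <;> simp <;> linarith
  have hwall := (isWall_removed i hx0 hx1).phiWord hy hxb w
  rw [zero_add] at hwall
  obtain ⟨k, b, hk, hav, t, ht, hbt, hint⟩ := hA
  have hstep := hwall.billiardStep (a := (b, velocity p s ε₂ 1)) ht hbt hint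
    (by simpa [velocity] using hs)
  have hbase : (!₂[x, 0] : Plane) ∈ base := by
    rw [mem_base_iff]
    exact ⟨hx0.le, hx1.le, rfl⟩
  have hmem : phiWord w (phi i !₂[x, 0]) ∈ removed w.length :=
    mem_removed_iff.2 ⟨w, rfl, i, _, hbase, rfl⟩
  have htime : firstEscapeTime w.length a = ((k + 1 : ℕ) : ℕ∞) :=
    (hav.mono subset_union_right).firstHit_eq (hk.succ hstep) hmem
  refine ⟨k, htime, ?_, (b, velocity p s ε₂ 1), _, hk, hstep, w ++ [i], by simp,
    ⟨_, hbase, phiWord_concat w i _⟩, ?_⟩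
  · rw [htime]
    exact ((hav.mono subset_union_left).succ (hk.succ hstep)
      (phiWord_not_mem_base hy)).lt_firstHit
  · have horigin : relativeOrigin (w ++ [i]) (velocity p s ε₂ 1) =
        phiWord (w ++ [i]) !₂[1 / 2 - ε₂ / 2, 0] := by
      have hps : 0 < (p : ℝ) * s := by positivity
      rw [relativeOrigin]
      rcases hε₂ with h | h
      · rw [h, if_pos (by simpa [velocity] using hps)]
        norm_num
      · rw [h, if_neg (by simpa [velocity] using hps.le)]
        norm_num
    have hsub : (!₂[x, 0] - !₂[1 / 2 - ε₂ / 2, 0] : Plane) =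
        EuclideanSpace.single 0 (ε₂ * r) := by
      ext j
      fin_cases j
      · simp [hx]
        ring
      · simp
    have habs : |ε₂| = 1 := by
      rcases hε₂ with h | h <;> simp [h]
    -- A word of length `n + 1` contracts distances by `2^(-(n+1))`, and `2^(-(n+1)) * fract
    -- (2^(n+1) * u)` is `u` minus its truncation.
    rw [horigin, ← phiWord_concat, dist_eq_norm, phiWord_sub, norm_smul, hsub,
      PiLp.norm_single, Real.norm_eq_abs, Real.norm_eq_abs, abs_mul, habs, one_mul,
      abs_of_pos h5, abs_of_pos (by positivity), hr, Int.fract, binaryTrunc]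
    simp only [List.length_append, List.length_singleton, one_div, inv_pow]
    field_simp

theorem initialCondition_eq {x θ : ℝ} (hp : Odd p) (h : Real.tan θ = ε * (1 / p))
    (hε : ε = 1 ∨ ε = -1) :
    initialCondition x θ = (!₂[x, 0], velocity p (Real.sin θ) ε 1) := by
  have hp0 : (0 : ℝ) < p := by exact_mod_cast hp.pos
  have hc : Real.cos θ ≠ 0 := by
    intro hc
    -- With zero cosine the tangent takes the default value 0, which is not `±1/p`.
    rw [Real.tan_eq_sin_div_cos, hc, div_zero] at h
    rcases hε with rfl | rfl <;> (simp [hp.pos.ne'] at h; try linarith)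
  have hs : Real.cos θ = ε * (p * Real.sin θ) := by
    rw [Real.tan_eq_sin_div_cos] at h
    field_simp at h
    rcases hε with rfl | rfl <;> linarith
  rw [initialCondition, velocity, ← hs, one_mul]

end Escape

theorem mainTheorem5 (p : ℕ) (hp : Odd p) (x : ℝ) (hx : x ∈ Set.Ioo (0 : ℝ) 1)
    (hdyadic : ∀ m l : ℕ, 0 < m → 0 < l → x ≠ (m : ℝ) / 2 ^ l)
    (θ : ℝ) (hθ : θ ∈ Set.Ioo (0 : ℝ) Real.pi) :
    (Real.tan θ = 1 / (p : ℝ) → ∀ n : ℕ,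
      EscapesAtDistance n (initialCondition x θ) (x - binaryTrunc (n + 1) x)) ∧
    (Real.tan θ = -(1 / (p : ℝ)) → ∀ n : ℕ,
      EscapesAtDistance n (initialCondition x θ)
        ((1 - x) - binaryTrunc (n + 1) (1 - x))) := by
  have hs : 0 < Real.sin θ := Real.sin_pos_of_pos_of_lt_pi hθ.1 hθ.2
  obtain ⟨hx0, hx1⟩ := hx
  have hdy : ∀ (j : ℕ) (z : ℤ), (2 : ℝ) ^ j * x ≠ z := by
    intro j z h
    have hz : (0 : ℝ) < z := h ▸ by positivity
    have hz' : 0 < z := by exact_mod_cast hz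
    lift z to ℕ using hz'.le
    -- Numerator and denominator are doubled because the hypothesis requires a positive exponent,
    -- while `j` may be 0.
    refine hdyadic (z * 2) (j + 1) (by omega) j.succ_pos ?_
    rw [Int.cast_natCast] at h
    rw [eq_div_iff (by positivity)]
    push_cast
    rw [← h]
    ring
  constructor
  · intro h n
    refine escapesAtDistance hp hs (Or.inl rfl) hdy hx0 hx1 ?_ n
    rw [initialCondition_eq hp (by rw [h, one_mul]) (Or.inl rfl), one_mul, add_sub_cancel]
  · intro h n
    -- The ball starts leftwards, so the endpoint behind it is the right one, at distance `1 - x`.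
    refine escapesAtDistance hp hs (Or.inr rfl) ?_ (by linarith) (by linarith) ?_ n
    · intro j z hz
      refine hdy j (2 ^ j - z) ?_
      push_cast
      linarith
    · rw [initialCondition_eq hp (by rw [h, neg_one_mul]) (Or.inr rfl)]
      congr 3
      ring
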